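/- For a finite simple graph $G=(V,E)$ with $p$ vertices and $q$ edges, a \emph{local antimagic total labeling} of $G$ is a bijection $f:V\cup E\to\{1,2,\dots,p+q\}$ such that $w_f(u)\neq w_f(v)$ for every edge $uv\in E$, where $w_f(u)=f(u)+\sum_{uv\in E}f(uv)$ is the weight of the vertex $u$. The \emph{local antimagic total chromatic number} $\chi_{lat}(G)$ is the minimum, over all local antimagic total labelings $f$ of $G$, of the number of distinct vertex weights $w_f(u)$, $u\in V$. For $m\ge 2$ and $n>r\ge 1$, let $A(mK_n,K_r)$ be the graph obtained from $m$ copies of the complete graph $K_n$, the $i$-th one having vertices $v_{i,1},\dots,v_{i,n}$, by identifying $v_{1,j}=v_{2,j}=\cdots=v_{m,j}$ for each $j$ with $n-r+1\le j\le n$ (so that the $m$ copies share a common $K_r$; parallel edges are merged). \textbf{Theorem.} Let $m\ge 2$, let $n\ge 3$ be odd, and let $n>r\ge 3$. Then $\chi_{lat}(A(mK_n,K_r))=n$. -/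

import Mathlib

open Classical in
/-- The weight `w_f(u) = f(u) + ∑_{uv ∈ E(G)} f(uv)` of a vertex `u` under a total labeling `f`
of the vertices and edges of `G`. -/
noncomputable def SimpleGraph.totalWeight {V : Type*} [Fintype V] (G : SimpleGraph V)
    (f : V ⊕ G.edgeSet → ℕ) (u : V) : ℕ :=
  f (Sum.inl u) +
    ∑ v : V, if h : G.Adj u v then f (Sum.inr ⟨s(u, v), G.mem_edgeSet.mpr h⟩) else 0

/-- `f` is a local antimagic total labeling of a graph `G` with `p` vertices and `q` edges:
a bijection from `V(G) ∪ E(G)` onto `{1, …, p + q}` such that adjacent vertices have different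
weights. -/
def SimpleGraph.IsLocalAntimagicTotal {V : Type*} [Fintype V] (G : SimpleGraph V)
    (f : V ⊕ G.edgeSet → ℕ) : Prop :=
  Set.BijOn f Set.univ (Set.Icc 1 (Fintype.card V + G.edgeSet.ncard)) ∧
    ∀ u v : V, G.Adj u v → G.totalWeight f u ≠ G.totalWeight f v

/-- The local antimagic total chromatic number `χ_lat(G)`: the minimum, over all local antimagic
total labelings of `G`, of the number of distinct vertex weights. (If there were no such labeling
the value would be `0`; a nonzero value is always attained.) -/
noncomputable def SimpleGraph.latChromaticNumber {V : Type*} [Fintype V]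
    (G : SimpleGraph V) : ℕ :=
  sInf {k : ℕ | ∃ f : V ⊕ G.edgeSet → ℕ,
    G.IsLocalAntimagicTotal f ∧ (Set.range (G.totalWeight f)).ncard = k}

/-- Vertices of `A(mK_n, K_r)` for `r < n`: each of the `m` copies of `K_n` has `n - r` vertices of
its own, and `r` vertices are common to all copies. -/
abbrev AmalgVertex (m n r : ℕ) : Type := (Fin m × Fin (n - r)) ⊕ Fin r

/-- The vertex `v_{i,j}` of `A(mK_n, K_r)`, that is, the image of the `j`-th vertex of the `i`-th
copy of `K_n`. The last `r` vertices of the copies are identified: for `j ≥ n - r` (counting from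
`0`) the vertex does not depend on `i`. -/
def amalgVertex (m n r : ℕ) (i : Fin m) (j : Fin n) : AmalgVertex m n r :=
  if h : (j : ℕ) < n - r then Sum.inl (i, ⟨j, h⟩)
  else Sum.inr ⟨j - (n - r), by omega⟩

/-- The amalgamation `A(mK_n, K_r)` of `m` copies of `K_n` over a common `K_r`: its edges are the
pairs `v_{i,j} v_{i,k}` with `j ≠ k`. -/
def amalgComplete (m n r : ℕ) : SimpleGraph (AmalgVertex m n r) where
  Adj a b := a ≠ b ∧ ∃ (i : Fin m) (j k : Fin n),
    amalgVertex m n r i j = a ∧ amalgVertex m n r i k = b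
  symm := ⟨by
    rintro a b ⟨hab, i, j, k, hj, hk⟩
    exact ⟨hab.symm, i, k, j, hk, hj⟩⟩
  loopless := ⟨fun _ h => h.1 rfl⟩

/-! Adjacent vertices differ in weight, so one copy of K_n already forces n weights; the task is a
labeling with only n. Put s = n - r and view copy i as a symmetric n × n array, with vertices on the
diagonal and edges off it. Indices below s belong to the copy alone, the others are common. The
weight of an own vertex is its row sum.

Two properties suffice: entries increase down every column, so that weights increase with the row
index (`rot_cell_lt`, `totalWeight_lt`), and row j < s has the same sum in all copies
(`row_sum_eq`). For the first, each index pair outside the common part gets a block of m consecutive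
labels, one per copy, column after column; only the last column interleaves its rows. The common
pairs come after these.

For the second, copy i takes place i or m - 1 - i alternately, so the first n - 3 columns (an even
number) cancel in pairs. In the last three columns (`sum_last_three`), all common because r ≥ 3,
place m - 1 - i occurs twice, against labels growing by 2 with i that come from interleaving two
rows. If s is odd, row s - 1 has no partner and uses three permutations of constant sum. For m even
that sum would be 3(m - 1)/2, not an integer; so the last block skips its middle label, which goes
to the first common vertex (`gap`, `rot`). -/

namespace AmalgLabel

/-! ### Numbering of the index pairs -/

/-- The triangular numbers `0, 1, 3, 6, …`. -/
def tri : ℕ → ℕ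
  | 0 => 0
  | k + 1 => tri k + (k + 1)

theorem tri_mono : Monotone tri := monotone_nat_of_le_succ fun k => by simp [tri]

theorem tri_add_lt {a b s : ℕ} (hab : a ≤ b) (hb : b < s) : tri b + a < tri s := by
  have h := tri_mono (Nat.succ_le_of_lt hb)
  simp only [tri] at h
  omega

theorem tri_add_inj {a b a' b' : ℕ} (h : a ≤ b) (h' : a' ≤ b') (he : tri b + a = tri b' + a') :
    a = a' ∧ b = b' := by
  rcases lt_trichotomy b b' with hb | rfl | hb
  · have := tri_add_lt h hb
    omega
  · omega
  · have := tri_add_lt h' hb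
    omega

theorem exists_tri_add_eq {s x : ℕ} (hx : x < tri s) :
    ∃ a b, a ≤ b ∧ b < s ∧ tri b + a = x := by
  induction s with
  | zero => simp [tri] at hx
  | succ s ih =>
    by_cases h : x < tri s
    · obtain ⟨a, b, h1, h2, h3⟩ := ih h
      exact ⟨a, b, h1, by omega, h3⟩
    · simp only [tri] at hx
      exact ⟨x - tri s, s, by omega, by omega, by omega⟩

/-- The number of the block of `m` labels that is used at the index pair `a ≤ b`, `a < s`. -/
def pos (s a b : ℕ) : ℕ := if b < s then tri b + a else tri s + (b - s) * s + a

theorem pos_lt_pos_right {s a b b' : ℕ} (hab : a ≤ b) (has : a < s) (hb : b < b') (a' : ℕ) :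
    pos s a b < pos s a' b' := by
  unfold pos
  split_ifs with h1 h2 h2
  · have := tri_add_lt hab hb
    omega
  · have := tri_add_lt hab h1
    omega
  · omega
  · have : (b - s + 1) * s ≤ (b' - s) * s := Nat.mul_le_mul_right _ (by omega)
    rw [add_mul] at this
    omega

theorem pos_lt_pos_left {s a a' b : ℕ} (h : a < a') : pos s a b < pos s a' b := by
  unfold pos
  split_ifs <;> omega

/-- At a fixed column of the symmetric array, a larger row index leads either to a later column of
the upper triangle or further down the same one. -/
theorem pos_min_max_lt {s j j' b : ℕ} (h : j < j') (hj : j' < s) :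
    pos s (min j b) (max j b) < pos s (min j' b) (max j' b) := by
  rcases lt_or_ge b j' with hb | hb
  · exact pos_lt_pos_right (by omega) (by omega) (by omega) _
  · rw [max_eq_right (h.le.trans hb), max_eq_right hb]
    exact pos_lt_pos_left (by omega)

theorem pos_lt {s a b k : ℕ} (hab : a ≤ b) (has : a < s) (hb : b < s + k) :
    pos s a b < tri s + k * s := by
  have := pos_lt_pos_right hab has hb 0
  simpa [pos] using this

theorem exists_pos_eq {s k x : ℕ} (hs : 0 < s) (hx : x < tri s + k * s) :
    ∃ a b, a ≤ b ∧ a < s ∧ b < s + k ∧ pos s a b = x := by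
  by_cases h : x < tri s
  · obtain ⟨a, b, h1, h2, h3⟩ := exists_tri_add_eq h
    exact ⟨a, b, h1, by omega, by omega, by simp [pos, h2, h3]⟩
  · have h1 := Nat.mod_lt (x - tri s) hs
    have h2 := Nat.div_add_mod' (x - tri s) s
    have h3 : (x - tri s) / s < k := Nat.div_lt_of_lt_mul (by rw [mul_comm]; omega)
    refine ⟨(x - tri s) % s, s + (x - tri s) / s, h1.le.trans (Nat.le_add_right _ _), h1,
      by omega, ?_⟩
    simp only [pos, add_lt_iff_neg_left, not_lt_zero, if_false, Nat.add_sub_cancel_left]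
    omega

/-! ### Distribution of a block among the copies -/

/-- Position inside its block of the label used by copy `i` at the index pair `a ≤ b`,
for all `b` but the last one. -/
def offset (m s r a b i : ℕ) : ℕ :=
  if b + 3 < s + r then (if (a + b) % 2 = 0 then i else m - 1 - i)
  else if a + 1 = s ∧ s % 2 = 1 then
    (if b + 3 = s + r then (if i < m / 2 then i + (m - m / 2) else i - m / 2)
    else (if i < m / 2 then 2 * (m / 2) - 1 - 2 * i else 2 * m - 2 - 2 * i))
  else m - 1 - i

theorem offset_lt {m s r a b i : ℕ} (hi : i < m) : offset m s r a b i < m := by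
  unfold offset
  split_ifs <;> omega

theorem offset_inj {m s r a b i i' : ℕ} (hi : i < m) (hi' : i' < m)
    (h : offset m s r a b i = offset m s r a b i') : i = i' := by
  unfold offset at h
  split_ifs at h <;> omega

theorem exists_offset_eq {m s r a b x : ℕ} (hx : x < m) : ∃ i < m, offset m s r a b i = x := by
  have hinj : Function.Injective
      (fun i : Fin m => (⟨offset m s r a b i, offset_lt i.2⟩ : Fin m)) := fun i j h =>
    Fin.ext (offset_inj i.2 j.2 (Fin.ext_iff.mp h))
  obtain ⟨i, hi⟩ := Finite.surjective_of_injective hinj ⟨x, hx⟩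
  exact ⟨i, i.2, Fin.ext_iff.mp hi⟩

/-- Labels at the last index, relative to the first of them: the rows `2k` and `2k + 1` take
alternate labels, a row that remains takes consecutive labels. -/
def lastCol (m s a i : ℕ) : ℕ :=
  if a + 1 = s ∧ s % 2 = 1 then m * a + i else 2 * m * (a / 2) + 2 * i + a % 2

/-- For odd s the paired rows exhaust the first m * (s - 1) labels and leave m consecutive ones to
row s - 1. -/
theorem lastCol_lt_of_lt {m s a i : ℕ} (ha : a + 1 < s) (hs : s % 2 = 1) (hi : i < m) :
    lastCol m s a i < m * (s - 1) := by
  have h1 : m * (2 * (a / 2 + 1)) ≤ m * (s - 1) := Nat.mul_le_mul_left _ (by omega)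
  have h2 : m * (2 * (a / 2 + 1)) = 2 * m * (a / 2) + 2 * m := by ring
  unfold lastCol
  split_ifs with h <;> omega

theorem lastCol_lt {m s a i : ℕ} (ha : a < s) (hi : i < m) : lastCol m s a i < m * s := by
  unfold lastCol
  split_ifs with h
  · have : m * s = m * a + m := by rw [← h.1]; ring
    omega
  · have h1 : m * (2 * (a / 2 + 1)) ≤ m * s := Nat.mul_le_mul_left _ (by omega)
    have h2 : m * (2 * (a / 2 + 1)) = 2 * m * (a / 2) + 2 * m := by ring
    omega

theorem lastCol_strictMono {m s a a' i : ℕ} (h : a < a') (ha : a' < s) (hi : i < m) :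
    lastCol m s a i < lastCol m s a' i := by
  by_cases hl : a' + 1 = s ∧ s % 2 = 1
  · have := lastCol_lt_of_lt (m := m) (s := s) (a := a) (by omega) hl.2 hi
    have h2 : lastCol m s a' i = m * a' + i := if_pos hl
    rw [h2]
    have : s - 1 = a' := by omega
    simp_all
    omega
  · have h1 : ¬ (a + 1 = s ∧ s % 2 = 1) := by omega
    simp only [lastCol, hl, h1, if_false]
    rcases (by omega : a / 2 = a' / 2 ∨ a / 2 + 1 ≤ a' / 2) with h2 | h2
    · rw [h2]
      omega
    · have := Nat.mul_le_mul_left (2 * m) h2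
      rw [mul_add] at this
      omega

theorem lastCol_inj {m s a i a' i' : ℕ} (ha : a < s) (hi : i < m) (ha' : a' < s) (hi' : i' < m)
    (h : lastCol m s a i = lastCol m s a' i') : i = i' ∧ a = a' := by
  by_cases hl : a + 1 = s ∧ s % 2 = 1 <;> by_cases hl' : a' + 1 = s ∧ s % 2 = 1
  · have : a = a' := by omega
    subst this
    simp only [lastCol, if_pos hl] at h
    omega
  · have h1 := lastCol_lt_of_lt (m := m) (s := s) (a := a') (by omega) hl.2 hi'
    have h2 : lastCol m s a i = m * a + i := if_pos hl
    rw [show s - 1 = a by omega] at h1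
    omega
  · have h1 := lastCol_lt_of_lt (m := m) (s := s) (a := a) (by omega) hl'.2 hi
    have h2 : lastCol m s a' i' = m * a' + i' := if_pos hl'
    rw [show s - 1 = a' by omega] at h1
    omega
  · simp only [lastCol, hl, hl', if_false] at h
    rcases lt_trichotomy (a / 2) (a' / 2) with h2 | h2 | h2
    · have := Nat.mul_le_mul_left (2 * m) (Nat.succ_le_of_lt h2)
      rw [Nat.succ_eq_add_one, mul_add] at this
      omega
    · rw [h2] at h
      omega
    · have := Nat.mul_le_mul_left (2 * m) (Nat.succ_le_of_lt h2)
      rw [Nat.succ_eq_add_one, mul_add] at this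
      omega

theorem exists_lastCol_eq {m s x : ℕ} (hx : x < m * s) :
    ∃ a < s, ∃ i < m, lastCol m s a i = x := by
  have hinj : Function.Injective
      (fun p : Fin m × Fin s => (⟨lastCol m s p.2 p.1, lastCol_lt p.2.2 p.1.2⟩ : Fin (m * s))) := by
    rintro ⟨i, a⟩ ⟨i', a'⟩ h
    obtain ⟨h1, h2⟩ := lastCol_inj a.2 i.2 a'.2 i'.2 (Fin.ext_iff.mp h)
    exact Prod.ext (Fin.ext h1) (Fin.ext h2)
  obtain ⟨p, hp⟩ := ((Fintype.bijective_iff_injective_and_card _).mpr ⟨hinj, by simp⟩).2 ⟨x, hx⟩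
  exact ⟨p.2, p.2.2, p.1, p.1.2, Fin.ext_iff.mp hp⟩

/-! ### Labels outside the common complete graph -/

/-- The number of labels that are used outside the common complete graph. -/
def ownTotal (m s r : ℕ) : ℕ := m * (tri s + r * s)

/-- The label (before rotation, counted from `0`) at the indices `a ≤ b`, `a < s`, of copy `i`. -/
def own (m s r i a b : ℕ) : ℕ :=
  if b + 1 < s + r then m * pos s a b + offset m s r a b i
  else m * (tri s + (r - 1) * s) + lastCol m s a i

theorem ownTotal_eq {m s r : ℕ} (hr : 0 < r) :
    ownTotal m s r = m * (tri s + (r - 1) * s) + m * s := by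
  obtain ⟨k, rfl⟩ : ∃ k, r = k + 1 := ⟨r - 1, by omega⟩
  simp only [ownTotal, Nat.add_sub_cancel]
  ring

theorem own_lt_of_lt {m s r i a b : ℕ} (hi : i < m) (hab : a ≤ b) (has : a < s)
    (hb : b + 1 < s + r) : own m s r i a b < m * (tri s + (r - 1) * s) := by
  have h1 : pos s a b + 1 ≤ tri s + (r - 1) * s := pos_lt hab has (by omega)
  have h2 := Nat.mul_le_mul_left m h1
  have h3 : offset m s r a b i < m := offset_lt hi
  rw [mul_add, mul_one] at h2
  rw [own, if_pos hb]
  omega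

theorem own_lt {m s r i a b : ℕ} (hr : 0 < r) (hi : i < m) (hab : a ≤ b) (has : a < s) :
    own m s r i a b < ownTotal m s r := by
  rw [ownTotal_eq hr]
  by_cases hb : b + 1 < s + r
  · have := own_lt_of_lt hi hab has hb
    omega
  · rw [own, if_neg hb]
    have := lastCol_lt (m := m) has hi
    omega

theorem own_lt_own_of_pos_lt {m s r i i' a b a' b' : ℕ} (hi : i < m)
    (hb : b + 1 < s + r) (hb' : b' + 1 < s + r) (h : pos s a b < pos s a' b') :
    own m s r i a b < own m s r i' a' b' := by
  rw [own, if_pos hb, own, if_pos hb']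
  have h2 := Nat.mul_le_mul_left m (Nat.succ_le_of_lt h)
  have h3 : offset m s r a b i < m := offset_lt hi
  rw [Nat.succ_eq_add_one, mul_add, mul_one] at h2
  omega

theorem own_lt_own_right {m s r i i' a b a' b' : ℕ} (hi : i < m) (hab : a ≤ b) (has : a < s)
    (hb' : b' < s + r) (h : b < b') : own m s r i a b < own m s r i' a' b' := by
  by_cases hl : b' + 1 < s + r
  · exact own_lt_own_of_pos_lt hi (by omega) hl (pos_lt_pos_right hab has h _)
  · have := own_lt_of_lt (r := r) hi hab has (by omega)
    rw [own.eq_def m s r i', if_neg hl]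
    omega

theorem own_row_lt {m s r i j j' b : ℕ} (hr : 0 < r) (hi : i < m) (h : j < j') (hj : j' < s)
    (hb : b < s + r) :
    own m s r i (min j b) (max j b) < own m s r i (min j' b) (max j' b) := by
  by_cases hl : b + 1 < s + r
  · exact own_lt_own_of_pos_lt hi (by omega) (by omega) (pos_min_max_lt h hj)
  · have h1 : ∀ k < s, min k b = k ∧ max k b = b := fun k hk => by omega
    rw [(h1 j (by omega)).1, (h1 j (by omega)).2, (h1 j' hj).1, (h1 j' hj).2, own, own, if_neg hl,
      if_neg hl]
    have := lastCol_strictMono (m := m) h hj hi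
    omega

theorem own_inj {m s r i a b i' a' b' : ℕ} (hi : i < m) (hab : a ≤ b) (has : a < s)
    (hb : b < s + r) (hi' : i' < m) (hab' : a' ≤ b') (has' : a' < s) (hb' : b' < s + r)
    (h : own m s r i a b = own m s r i' a' b') : i = i' ∧ a = a' ∧ b = b' := by
  rcases lt_trichotomy b b' with hlt | rfl | hlt
  · exact absurd h (own_lt_own_right hi hab has hb' hlt).ne
  · by_cases hl : b + 1 < s + r
    · rcases lt_trichotomy a a' with ha | rfl | ha
      · exact absurd h (own_lt_own_of_pos_lt hi hl hl (pos_lt_pos_left ha)).ne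
      · rw [own, own, if_pos hl, if_pos hl] at h
        exact ⟨offset_inj hi hi' (Nat.add_left_cancel h), rfl, rfl⟩
      · exact absurd h (own_lt_own_of_pos_lt hi' hl hl (pos_lt_pos_left ha)).ne'
    · rw [own, own, if_neg hl, if_neg hl] at h
      obtain ⟨h1, h2⟩ := lastCol_inj has hi has' hi' (Nat.add_left_cancel h)
      exact ⟨h1, h2, rfl⟩
  · exact absurd h (own_lt_own_right hi' hab' has' hb hlt).ne'

theorem exists_own_eq {m s r x : ℕ} (hs : 0 < s) (hr : 0 < r) (hx : x < ownTotal m s r) :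
    ∃ i < m, ∃ a b, a ≤ b ∧ a < s ∧ b < s + r ∧ own m s r i a b = x := by
  rw [ownTotal_eq hr] at hx
  by_cases h : x < m * (tri s + (r - 1) * s)
  · have hm : 0 < m := Nat.pos_of_ne_zero (by rintro rfl; simp at h)
    obtain ⟨a, b, h1, h2, h3, h4⟩ := exists_pos_eq hs (Nat.div_lt_of_lt_mul h)
    obtain ⟨i, hi, h5⟩ := exists_offset_eq (s := s) (r := r) (a := a) (b := b) (Nat.mod_lt x hm)
    refine ⟨i, hi, a, b, h1, h2, by omega, ?_⟩
    rw [own, if_pos (by omega), h4, h5, Nat.div_add_mod]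
  · obtain ⟨a, ha, i, hi, h1⟩ := exists_lastCol_eq (m := m) (s := s)
      (x := x - m * (tri s + (r - 1) * s)) (by omega)
    refine ⟨i, hi, a, s + r - 1, by omega, ha, by omega, ?_⟩
    rw [own, if_neg (by omega), h1]
    omega

/-! ### Freeing a label in the last block -/

/-- The label that remains free in the last block if this block has to have an integral mean. -/
def gap (m s r : ℕ) : ℕ :=
  if s % 2 = 1 ∧ m % 2 = 0 then ownTotal m s r - m + m / 2 else ownTotal m s r

/-- Moves the label `ownTotal m s r` to `gap m s r` and the labels between them up by one. -/
def rot (m s r x : ℕ) : ℕ :=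
  if x = ownTotal m s r then gap m s r
  else if gap m s r ≤ x ∧ x < ownTotal m s r then x + 1 else x

theorem gap_le (m s r : ℕ) (hs : 0 < s) (hr : 0 < r) :
    m * (tri s + (r - 1) * s) ≤ gap m s r ∧ gap m s r ≤ ownTotal m s r := by
  have h := ownTotal_eq (m := m) (s := s) hr
  have h1 : m * 1 ≤ m * s := Nat.mul_le_mul_left _ hs
  unfold gap
  split_ifs <;> omega

/-- The moved label is the only one that changes its place in the order. -/
theorem rot_lt_rot {m s r x y : ℕ} (hx : x ≠ ownTotal m s r) (hy : y ≠ ownTotal m s r)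
    (h : x < y) : rot m s r x < rot m s r y := by
  unfold rot
  split_ifs <;> omega

theorem rot_of_lt {m s r x : ℕ} (hs : 0 < s) (hr : 0 < r) (h : x < gap m s r) :
    rot m s r x = x := by
  have := gap_le m s r hs hr
  unfold rot
  split_ifs <;> omega

theorem rot_inj {m s r x y : ℕ} (hs : 0 < s) (hr : 0 < r) (h : rot m s r x = rot m s r y) :
    x = y := by
  have := gap_le m s r hs hr
  unfold rot at h
  split_ifs at h <;> omega

theorem rot_lt {m s r x N : ℕ} (hs : 0 < s) (hr : 0 < r) (hN : ownTotal m s r < N)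
    (hx : x < N) : rot m s r x < N := by
  have := gap_le m s r hs hr
  unfold rot
  split_ifs <;> omega

theorem exists_rot_eq {m s r x N : ℕ} (hs : 0 < s) (hr : 0 < r) (hN : ownTotal m s r < N)
    (hx : x < N) : ∃ y < N, rot m s r y = x := by
  have hinj : Function.Injective
      (fun i : Fin N => (⟨rot m s r i, rot_lt hs hr hN i.2⟩ : Fin N)) := fun i j h =>
    Fin.ext (rot_inj hs hr (Fin.ext_iff.mp h))
  obtain ⟨i, hi⟩ := Finite.surjective_of_injective hinj ⟨x, hx⟩
  exact ⟨i, i.2, Fin.ext_iff.mp hi⟩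

/-! ### Equal row sums in all copies -/

theorem sum_alternating (m i j t : ℕ) (hi : i < m) :
    ∑ b ∈ Finset.range (2 * t), (if (j + b) % 2 = 0 then i else m - 1 - i) = t * (m - 1) := by
  induction t with
  | zero => simp
  | succ t ih =>
    rw [show 2 * (t + 1) = 2 * t + 1 + 1 by ring, Finset.sum_range_succ, Finset.sum_range_succ, ih,
      add_mul]
    split_ifs <;> omega

/-- The labels that a row of copy `i` has at the last three indices have a sum that does not
depend on `i`. -/
theorem sum_last_three {m s r i i' j t : ℕ} (hr : 3 ≤ r) (ht : s + r = 2 * t + 3) (hi : i < m)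
    (hi' : i' < m) (hj : j < s) :
    own m s r i j (2 * t) + own m s r i j (2 * t + 1) + rot m s r (own m s r i j (2 * t + 2)) =
    own m s r i' j (2 * t) + own m s r i' j (2 * t + 1) +
      rot m s r (own m s r i' j (2 * t + 2)) := by
  have hT := ownTotal_eq (m := m) (s := s) (r := r) (by omega)
  have hs : 0 < s := by omega
  have e0 : ∀ i, own m s r i j (2 * t) = m * pos s j (2 * t) + offset m s r j (2 * t) i :=
    fun i => if_pos (by omega)
  have e1 : ∀ i, own m s r i j (2 * t + 1) =
      m * pos s j (2 * t + 1) + offset m s r j (2 * t + 1) i := fun i => if_pos (by omega)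
  have e2 : ∀ i, own m s r i j (2 * t + 2) = m * (tri s + (r - 1) * s) + lastCol m s j i :=
    fun i => if_neg (by omega)
  rw [e0, e1, e2, e0, e1, e2]
  set P := m * pos s j (2 * t)
  set Q := m * pos s j (2 * t + 1)
  set R := m * (tri s + (r - 1) * s)
  have n0 : ¬ (2 * t + 3 < s + r) := by omega
  have n1 : ¬ (2 * t + 1 + 3 < s + r) := by omega
  have n2 : 2 * t + 3 = s + r := by omega
  have n3 : ¬ (2 * t + 1 + 3 = s + r) := by omega
  by_cases hl : j + 1 = s ∧ s % 2 = 1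
  · have hms : m * s = m * j + m := by rw [← hl.1]; ring
    -- The unpaired row: the two offsets and the place in the last block, shifted by one from m / 2
    -- on when m is even, have constant sum.
    have key : ∀ i < m, offset m s r j (2 * t) i + offset m s r j (2 * t + 1) i +
        rot m s r (R + lastCol m s j i) = R + m * j + (m - 1 + m / 2) := by
      intro i hi
      simp only [offset, n1, n2, n3, hl, and_self, if_true, if_false, lastCol, rot, gap,
        true_and]
      split_ifs <;> omega
    have k1 := key i hi
    have k2 := key i' hi'
    omega
  -- A paired row: 2 * i from the last column cancels m - 1 - i taken twice.
  · have key : ∀ i < m, offset m s r j (2 * t) i + offset m s r j (2 * t + 1) i +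
        rot m s r (R + lastCol m s j i) = R + 2 * m * (j / 2) + j % 2 + 2 * (m - 1) := by
      intro i hi
      -- The gap, if any, lies among the last m labels, which belong to the unpaired row.
      have hlt : R + lastCol m s j i < gap m s r := by
        unfold gap
        split_ifs with hg
        · have h1 := lastCol_lt_of_lt (m := m) (s := s) (a := j) (by omega) hg.1 hi
          have h2 : m * s = m * (s - 1) + m := by
            rw [← Nat.mul_succ]
            congr 1
            omega
          omega
        · have := lastCol_lt (m := m) hj hi
          omega
      rw [rot_of_lt hs (by omega) hlt]
      simp only [offset, n0, n1, hl, if_false, lastCol]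
      omega
    have k1 := key i hi
    have k2 := key i' hi'
    omega

theorem rot_own_of_lt {m s r i a b : ℕ} (hr : 0 < r) (hi : i < m) (hab : a ≤ b) (has : a < s)
    (hb : b + 1 < s + r) : rot m s r (own m s r i a b) = own m s r i a b :=
  rot_of_lt (by omega) hr
    ((own_lt_of_lt hi hab has hb).trans_le (gap_le m s r (by omega) hr).1)

/-- All copies have the same weight in row `j`. -/
theorem row_sum_eq {m s r i i' j : ℕ} (hr : 3 ≤ r) (hodd : Odd (s + r)) (hi : i < m)
    (hi' : i' < m) (hj : j < s) :
    ∑ b ∈ Finset.range (s + r), rot m s r (own m s r i (min j b) (max j b)) =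
    ∑ b ∈ Finset.range (s + r), rot m s r (own m s r i' (min j b) (max j b)) := by
  obtain ⟨k, hk⟩ := hodd
  obtain ⟨t, ht⟩ : ∃ t, s + r = 2 * t + 3 := ⟨k - 1, by omega⟩
  have split : ∀ i < m,
      ∑ b ∈ Finset.range (s + r), rot m s r (own m s r i (min j b) (max j b)) =
      (∑ b ∈ Finset.range (2 * t), m * pos s (min j b) (max j b)) + t * (m - 1) +
      (own m s r i j (2 * t) + own m s r i j (2 * t + 1) +
        rot m s r (own m s r i j (2 * t + 2))) := by
    intro i hi
    rw [← sum_alternating m i j t hi, ← Finset.sum_add_distrib, ht, Finset.sum_range_succ,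
      Finset.sum_range_succ, Finset.sum_range_succ]
    have hmm : ∀ b, s ≤ b → min j b = j ∧ max j b = b := fun b hb => by omega
    rw [(hmm (2 * t) (by omega)).1, (hmm (2 * t) (by omega)).2, (hmm (2 * t + 1) (by omega)).1,
      (hmm (2 * t + 1) (by omega)).2, (hmm (2 * t + 2) (by omega)).1,
      (hmm (2 * t + 2) (by omega)).2, rot_own_of_lt (by omega) hi (by omega) hj (by omega),
      rot_own_of_lt (by omega) hi (by omega) hj (by omega), add_assoc, add_assoc, add_assoc]
    congr 1
    refine Finset.sum_congr rfl fun b hb => ?_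
    rw [Finset.mem_range] at hb
    rw [rot_own_of_lt (by omega) hi (by omega) (by omega) (by omega), own, if_pos (by omega),
      offset, if_pos (by omega), min_add_max]
  rw [split i hi, split i' hi', sum_last_three hr ht hi hi' hj]

/-! ### The whole array and its monotonicity -/

/-- The label, before rotation and counted from `0`, at the indices `a ≤ b` of copy `i`. -/
def cell (m s r i a b : ℕ) : ℕ :=
  if a < s then own m s r i a b else ownTotal m s r + (tri (b - s) + (a - s))

theorem cell_lt {m s r i a b : ℕ} (hr : 0 < r) (hi : i < m) (hab : a ≤ b) (hb : b < s + r) :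
    cell m s r i a b < ownTotal m s r + tri r := by
  unfold cell
  split_ifs with h
  · have := own_lt hr hi hab h
    omega
  · have : tri (b - s) + (a - s) < tri r := tri_add_lt (by omega) (by omega)
    omega

theorem exists_cell_eq {m s r x : ℕ} (hm : 0 < m) (hs : 0 < s) (hr : 0 < r)
    (hx : x < ownTotal m s r + tri r) :
    ∃ i < m, ∃ a b, a ≤ b ∧ b < s + r ∧ cell m s r i a b = x := by
  by_cases h : x < ownTotal m s r
  · obtain ⟨i, hi, a, b, hab, has, hb, he⟩ := exists_own_eq hs hr h
    exact ⟨i, hi, a, b, hab, hb, by rw [cell, if_pos has, he]⟩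
  · obtain ⟨a, b, hab, hb, he⟩ := exists_tri_add_eq (s := r) (x := x - ownTotal m s r) (by omega)
    refine ⟨0, hm, s + a, s + b, by omega, by omega, ?_⟩
    rw [cell, if_neg (by omega), Nat.add_sub_cancel_left, Nat.add_sub_cancel_left]
    omega

theorem cell_inj {m s r i a b i' a' b' : ℕ} (hr : 0 < r) (hi : i < m) (hab : a ≤ b)
    (hb : b < s + r) (hi' : i' < m) (hab' : a' ≤ b') (hb' : b' < s + r)
    (h : cell m s r i a b = cell m s r i' a' b') : (a < s → i = i') ∧ a = a' ∧ b = b' := by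
  unfold cell at h
  split_ifs at h with h1 h2 h2
  · obtain ⟨e1, e2, e3⟩ := own_inj hi hab h1 hb hi' hab' h2 hb' h
    exact ⟨fun _ => e1, e2, e3⟩
  · have := own_lt hr hi hab h1
    omega
  · have := own_lt hr hi' hab' h2
    omega
  · obtain ⟨e1, e2⟩ := tri_add_inj (a := a - s) (b := b - s) (a' := a' - s) (b' := b' - s)
      (by omega) (by omega) (by omega)
    exact ⟨fun h => absurd h h1, by omega, by omega⟩

/-- Only the entry (s, s) can be lowered by the rotation. It stays above the own entries of column
s, since r ≥ 2 keeps that column apart from the last one, where the gap lies. -/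
theorem rot_cell_lt {m s r i j k b : ℕ} (hs : 0 < s) (hr : 2 ≤ r) (hi : i < m) (hjk : j < k)
    (hk : k < s + r) (hb : b < s + r) :
    rot m s r (cell m s r i (min j b) (max j b)) <
      rot m s r (cell m s r i (min k b) (max k b)) := by
  have hgap := gap_le m s r hs (by omega)
  have hown : ∀ a c, a ≤ c → a < s → own m s r i a c < ownTotal m s r := fun a c =>
    own_lt (by omega) hi
  rcases lt_or_ge (min k b) s with h1 | h1
  · rw [cell, cell, if_pos h1, if_pos (show min j b < s by omega)]
    refine rot_lt_rot (hown _ _ (by omega) (by omega)).ne (hown _ _ (by omega) (by omega)).ne ?_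
    rcases lt_or_ge k s with h2 | h2
    · exact own_row_lt (by omega) hi hjk h2 hb
    · exact own_lt_own_right hi (by omega) (by omega) (by omega) (by omega)
  · rw [cell.eq_def m s r i (min k b), if_neg (by omega)]
    rcases lt_or_ge j s with h2 | h2
    · rw [show min j b = j by omega, show max j b = b by omega, cell, if_pos h2]
      have hlt := hown j b (by omega) h2
      by_cases h0 : tri (max k b - s) + (min k b - s) = 0
      -- Here the larger entry is (s, s).
      · have h3 : max k b - s = 0 := by
          by_contra hne
          have : tri 1 ≤ tri (max k b - s) := tri_mono (by omega)
          simp only [tri] at this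
          omega
        have h4 := own_lt_of_lt (r := r) (b := b) hi (by omega) h2 (by omega)
        rw [rot_of_lt hs (by omega) (h4.trans_le hgap.1), h0, rot, if_pos (by omega)]
        omega
      · exact rot_lt_rot hlt.ne (by omega) (by omega)
    · rw [cell, if_neg (by omega)]
      have hlt : tri (max j b - s) + (min j b - s) < tri (max k b - s) + (min k b - s) := by
        rcases lt_or_ge b k with h3 | h3
        · have : tri (max j b - s) + (min j b - s) < tri (max k b - s) :=
            tri_add_lt (by omega) (by omega)
          omega
        · rw [max_eq_right h3, max_eq_right (by omega : j ≤ b)]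
          omega
      by_cases h0 : tri (max j b - s) + (min j b - s) = 0
      · rw [h0, rot, if_pos (by omega), rot, if_neg (by omega), if_neg (by omega)]
        omega
      · exact rot_lt_rot (by omega) (by omega) (by omega)

/-! ### Transfer to the graph -/

variable {m n r : ℕ}

theorem amalgVertex_of_lt (i : Fin m) {j : Fin n} (h : (j : ℕ) < n - r) :
    amalgVertex m n r i j = Sum.inl (i, ⟨j, h⟩) := dif_pos h

theorem amalgVertex_of_ge (i : Fin m) {j : Fin n} (h : ¬ (j : ℕ) < n - r) :
    amalgVertex m n r i j = Sum.inr ⟨j - (n - r), by omega⟩ := dif_neg h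

theorem amalgVertex_congr {i i' : Fin m} {j : Fin n} (h : (j : ℕ) < n - r → i = i') :
    amalgVertex m n r i j = amalgVertex m n r i' j := by
  by_cases hj : (j : ℕ) < n - r
  · rw [h hj]
  · rw [amalgVertex_of_ge i hj, amalgVertex_of_ge i' hj]

theorem amalgVertex_inj {i i' : Fin m} {j j' : Fin n}
    (h : amalgVertex m n r i j = amalgVertex m n r i' j') :
    j = j' ∧ ((j : ℕ) < n - r → i = i') := by
  unfold amalgVertex at h
  split_ifs at h with h1 h2 h2
  · simp only [Sum.inl.injEq, Prod.mk.injEq, Fin.mk.injEq] at h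
    exact ⟨Fin.ext h.2, fun _ => h.1⟩
  · simp only [Sum.inr.injEq, Fin.mk.injEq] at h
    exact ⟨Fin.ext (by omega), fun h => absurd h h1⟩

theorem exists_amalgVertex_eq (hm : 0 < m) (hrn : r < n) (v : AmalgVertex m n r) :
    ∃ i j, amalgVertex m n r i j = v := by
  rcases v with ⟨i, j⟩ | c
  · exact ⟨i, ⟨j, by omega⟩, amalgVertex_of_lt i j.2⟩
  · refine ⟨⟨0, hm⟩, ⟨n - r + c, by omega⟩, ?_⟩
    rw [amalgVertex_of_ge _ (by simp)]
    simp

/-- The label, before rotation and counted from `0`, at a pair of vertices of a common copy. -/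
def raw : AmalgVertex m n r → AmalgVertex m n r → ℕ
  | Sum.inl p, Sum.inl q => own m (n - r) r (min p.1 q.1 : Fin m) (min p.2 q.2 : Fin (n - r))
      (max p.2 q.2 : Fin (n - r))
  | Sum.inl p, Sum.inr c => own m (n - r) r p.1 p.2 (n - r + c)
  | Sum.inr c, Sum.inl p => own m (n - r) r p.1 p.2 (n - r + c)
  | Sum.inr c, Sum.inr d => ownTotal m (n - r) r + (tri (max c d : Fin r) + (min c d : Fin r))

/-- Symmetry extends to vertices of different copies through the irrelevant choice of the smaller
copy number, so the label descends to `Sym2`. -/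
theorem raw_comm (u v : AmalgVertex m n r) : raw u v = raw v u := by
  rcases u with p | c <;> rcases v with q | d
  · simp only [raw, min_comm, max_comm]
  · rfl
  · rfl
  · simp only [raw, min_comm, max_comm]

theorem raw_amalgVertex (i : Fin m) (a b : Fin n) :
    raw (amalgVertex m n r i a) (amalgVertex m n r i b) =
      cell m (n - r) r i (min (a : ℕ) b) (max (a : ℕ) b) := by
  wlog hab : a ≤ b generalizing a b
  · rw [raw_comm, this b a (le_of_not_ge hab), min_comm, max_comm]
  have hab' : (a : ℕ) ≤ b := hab
  rw [min_eq_left hab', max_eq_right hab']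
  unfold amalgVertex cell
  split_ifs with h1 h2 h2
  · simp [raw, hab']
  · simp only [raw]
    rw [Nat.add_sub_cancel' (by omega)]
  · omega
  · simp only [raw]
    rw [max_eq_right (Fin.mk_le_mk.mpr (by omega)), min_eq_left (Fin.mk_le_mk.mpr (by omega))]

/-- The label at an unordered pair of vertices of a common copy; a pair of equal vertices stands
for the vertex. -/
def label : Sym2 (AmalgVertex m n r) → ℕ :=
  Sym2.lift ⟨fun u v => rot m (n - r) r (raw u v) + 1, fun u v => by simp only [raw_comm u v]⟩

theorem label_amalgVertex (i : Fin m) (a b : Fin n) :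
    label s(amalgVertex m n r i a, amalgVertex m n r i b) =
      rot m (n - r) r (cell m (n - r) r i (min (a : ℕ) b) (max (a : ℕ) b)) + 1 := by
  rw [← raw_amalgVertex]
  rfl

/-- The total labeling of `A(mK_n, K_r)`. -/
def labeling (m n r : ℕ) : AmalgVertex m n r ⊕ (amalgComplete m n r).edgeSet → ℕ :=
  Sum.elim (fun u => label s(u, u)) fun e => label e.1

/-- The two vertices lie in a common copy of `K_n`. -/
def InCopy (u v : AmalgVertex m n r) : Prop :=
  ∃ (i : Fin m) (j k : Fin n), amalgVertex m n r i j = u ∧ amalgVertex m n r i k = v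

theorem adj_iff {u v : AmalgVertex m n r} :
    (amalgComplete m n r).Adj u v ↔ u ≠ v ∧ InCopy u v := Iff.rfl

theorem inCopy_self (hm : 0 < m) (hrn : r < n) (u : AmalgVertex m n r) : InCopy u u := by
  obtain ⟨i, j, h⟩ := exists_amalgVertex_eq hm hrn u
  exact ⟨i, j, j, h, h⟩

theorem label_injOn (hr : 0 < r) (hrn : r < n) {u v u' v' : AmalgVertex m n r}
    (h : InCopy u v) (h' : InCopy u' v') (he : label s(u, v) = label s(u', v')) :
    s(u, v) = s(u', v') := by
  have sorted : ∀ {u v : AmalgVertex m n r}, InCopy u v → ∃ (i : Fin m) (j k : Fin n), j ≤ k ∧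
      s(u, v) = s(amalgVertex m n r i j, amalgVertex m n r i k) := by
    rintro u v ⟨i, j, k, rfl, rfl⟩
    rcases le_total j k with hjk | hjk
    · exact ⟨i, j, k, hjk, rfl⟩
    · exact ⟨i, k, j, hjk, Sym2.eq_swap⟩
  obtain ⟨i, a, b, hab, e⟩ := sorted h
  obtain ⟨i', a', b', hab', e'⟩ := sorted h'
  have hab1 : (a : ℕ) ≤ b := hab
  have hab1' : (a' : ℕ) ≤ b' := hab'
  rw [e, e', label_amalgVertex, label_amalgVertex, min_eq_left hab1, max_eq_right hab1,
    min_eq_left hab1', max_eq_right hab1'] at he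
  obtain ⟨h1, h2, h3⟩ := cell_inj hr i.2 hab1 (by omega) i'.2 hab1' (by omega)
    (rot_inj (by omega) hr (Nat.add_right_cancel he))
  obtain rfl := Fin.ext h2
  obtain rfl := Fin.ext h3
  -- If the larger index b is own, so is a ≤ b, and the copies agree; otherwise the copy does not
  -- matter.
  rw [e, e', amalgVertex_congr (i := i) (i' := i') (j := a) fun h => Fin.ext (h1 h),
    amalgVertex_congr (i := i) (i' := i') (j := b) fun h => Fin.ext (h1 (by omega))]

theorem labeling_injective (hm : 0 < m) (hr : 0 < r) (hrn : r < n) :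
    Function.Injective (labeling m n r) := by
  rintro (u | ⟨⟨u, v⟩, hu⟩) (u' | ⟨⟨u', v'⟩, hu'⟩) h
  · have := label_injOn hr hrn (inCopy_self hm hrn u) (inCopy_self hm hrn u') h
    simp only [Sym2.eq_iff, and_self, or_self] at this
    rw [this]
  · have := label_injOn hr hrn (inCopy_self hm hrn u) (adj_iff.mp hu').2 h
    simp only [Sym2.eq_iff] at this
    exact absurd (by grind) (adj_iff.mp hu').1
  · have := label_injOn hr hrn (adj_iff.mp hu).2 (inCopy_self hm hrn u') h
    simp only [Sym2.eq_iff] at this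
    exact absurd (by grind) (adj_iff.mp hu).1
  · have := label_injOn hr hrn (adj_iff.mp hu).2 (adj_iff.mp hu').2 h
    exact congrArg Sum.inr (Subtype.ext this)

theorem label_mem (hr : 0 < r) (hrn : r < n) {u v : AmalgVertex m n r} (h : InCopy u v) :
    label s(u, v) ∈ Set.Icc 1 (ownTotal m (n - r) r + tri r) := by
  obtain ⟨i, a, b, rfl, rfl⟩ := h
  have hpos : 0 < tri r := by simpa [tri] using tri_add_lt (le_refl 0) hr
  have := rot_lt (m := m) (s := n - r) (r := r) (by omega) hr (by omega)
    (cell_lt hr i.2 min_le_max (by omega : max (a : ℕ) b < n - r + r))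
  rw [label_amalgVertex, Set.mem_Icc]
  omega

theorem range_labeling (hm : 0 < m) (hr : 0 < r) (hrn : r < n) :
    Set.range (labeling m n r) = Set.Icc 1 (ownTotal m (n - r) r + tri r) := by
  refine Set.Subset.antisymm ?_ ?_
  · rintro _ ⟨u | ⟨⟨u, v⟩, hu⟩, rfl⟩
    · exact label_mem hr hrn (inCopy_self hm hrn u)
    · exact label_mem hr hrn (adj_iff.mp hu).2
  · intro x hx
    rw [Set.mem_Icc] at hx
    have hpos : 0 < tri r := by simpa [tri] using tri_add_lt (le_refl 0) hr
    obtain ⟨y, hy, hxy⟩ := exists_rot_eq (m := m) (s := n - r) (r := r) (x := x - 1)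
      (N := ownTotal m (n - r) r + tri r) (by omega) hr (by omega) (by omega)
    obtain ⟨i, hi, a, b, hab, hb, rfl⟩ := exists_cell_eq hm (by omega) hr hy
    have hl := label_amalgVertex (r := r) (⟨i, hi⟩ : Fin m) (⟨a, by omega⟩ : Fin n) ⟨b, by omega⟩
    simp only [min_eq_left hab, max_eq_right hab, hxy] at hl
    rw [Nat.sub_add_cancel hx.1] at hl
    by_cases he : a = b
    · subst he
      exact ⟨Sum.inl _, hl⟩
    · have hne : amalgVertex m n r ⟨i, hi⟩ ⟨a, by omega⟩ ≠
          amalgVertex m n r ⟨i, hi⟩ ⟨b, by omega⟩ := fun h =>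
        he (Fin.ext_iff.mp (amalgVertex_inj h).1)
      exact ⟨Sum.inr ⟨s(_, _), ⟨hne, _, _, _, rfl, rfl⟩⟩, hl⟩

theorem labeling_bijOn (hm : 0 < m) (hr : 0 < r) (hrn : r < n) :
    Set.BijOn (labeling m n r) Set.univ
      (Set.Icc 1 (Fintype.card (AmalgVertex m n r) + (amalgComplete m n r).edgeSet.ncard)) := by
  classical
  have hrange := range_labeling (m := m) hm hr hrn
  have hinj := labeling_injective (m := m) hm hr hrn
  have hcard : Fintype.card (AmalgVertex m n r) + (amalgComplete m n r).edgeSet.ncard =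
      ownTotal m (n - r) r + tri r := by
    -- The edges need no separate count: injectivity and the known range determine p + q.
    have h1 := Set.ncard_range_of_injective hinj
    rw [hrange, Nat.card_sum, Nat.card_eq_fintype_card] at h1
    rw [← Nat.card_coe_set_eq, ← h1, ← Finset.coe_Icc, Set.ncard_coe_finset, Nat.card_Icc]
    omega
  rw [hcard, ← hrange, ← Set.image_univ]
  exact hinj.injOn.bijOn_image

/-! ### Weights -/

open Classical in
theorem totalWeight_labeling (hm : 0 < m) (hrn : r < n) (u : AmalgVertex m n r) :
    (amalgComplete m n r).totalWeight (labeling m n r) u =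
      ∑ v, if InCopy u v then label s(u, v) else 0 := by
  have h1 : labeling m n r (Sum.inl u) = ∑ v, if u = v then label s(u, v) else 0 := by
    rw [Finset.sum_ite_eq]
    simp [labeling]
  rw [SimpleGraph.totalWeight, h1, ← Finset.sum_add_distrib]
  refine Finset.sum_congr rfl fun v _ => ?_
  by_cases huv : u = v
  · subst huv
    simp [inCopy_self hm hrn u]
  · by_cases hc : InCopy u v
    · have : (amalgComplete m n r).Adj u v := ⟨huv, hc⟩
      simp [huv, hc, this, labeling]
    · have : ¬ (amalgComplete m n r).Adj u v := fun h => hc h.2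
      simp [huv, hc, this]

/-- The closed neighbourhood of the lower row is contained in that of the higher one, and labels
increase termwise there; further neighbours only add. -/
theorem totalWeight_lt (hm : 0 < m) (hr : 2 ≤ r) (hrn : r < n) (i : Fin m) {j k : Fin n}
    (hjk : j < k) :
    (amalgComplete m n r).totalWeight (labeling m n r) (amalgVertex m n r i j) <
      (amalgComplete m n r).totalWeight (labeling m n r) (amalgVertex m n r i k) := by
  classical
  have hjk' : (j : ℕ) < k := hjk
  have key : ∀ v, InCopy (amalgVertex m n r i j) v → InCopy (amalgVertex m n r i k) v ∧
      label s(amalgVertex m n r i j, v) < label s(amalgVertex m n r i k, v) := by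
    rintro _ ⟨i', a, b, ha, rfl⟩
    obtain ⟨rfl, h2⟩ := amalgVertex_inj ha
    have hk : amalgVertex m n r i k = amalgVertex m n r i' k :=
      amalgVertex_congr fun h => (h2 (by omega)).symm
    rw [← ha, hk, label_amalgVertex, label_amalgVertex]
    exact ⟨⟨i', k, b, rfl, rfl⟩, Nat.add_lt_add_right
      (rot_cell_lt (by omega) hr i'.2 hjk' (by omega) (by omega)) 1⟩
  rw [totalWeight_labeling hm hrn, totalWeight_labeling hm hrn]
  refine Finset.sum_lt_sum (fun v _ => ?_) ⟨amalgVertex m n r i j, Finset.mem_univ _, ?_⟩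
  · split_ifs with h1 h2 h2
    · exact (key v h1).2.le
    · exact absurd (key v h1).1 h2
    · exact Nat.zero_le _
    · exact le_rfl
  · have h := inCopy_self hm hrn (amalgVertex m n r i j)
    rw [if_pos h, if_pos (key _ h).1]
    exact (key _ h).2

theorem totalWeight_own (hm : 0 < m) (hrn : r < n) (i : Fin m) {j : Fin n}
    (hj : (j : ℕ) < n - r) :
    (amalgComplete m n r).totalWeight (labeling m n r) (amalgVertex m n r i j) =
      ∑ b ∈ Finset.range (n - r + r),
        rot m (n - r) r (own m (n - r) r i (min j b) (max j b)) + (n - r + r) := by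
  classical
  rw [totalWeight_labeling hm hrn, ← Finset.sum_filter]
  -- An own vertex sees its own copy only.
  have himg : Finset.univ.filter (fun v => InCopy (amalgVertex m n r i j) v) =
      Finset.univ.image (amalgVertex m n r i) := by
    ext v
    simp only [Finset.mem_filter, Finset.mem_univ, true_and, Finset.mem_image]
    constructor
    · rintro ⟨i', a, b, ha, rfl⟩
      obtain ⟨rfl, h2⟩ := amalgVertex_inj ha
      rw [h2 hj]
      exact ⟨b, rfl⟩
    · rintro ⟨b, rfl⟩
      exact ⟨i, j, b, rfl, rfl⟩
  rw [himg, Finset.sum_image fun a _ b _ h => (amalgVertex_inj h).1, Nat.sub_add_cancel hrn.le,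
    ← Fin.sum_univ_eq_sum_range
      (fun b => rot m (n - r) r (own m (n - r) r i (min j b) (max j b)))]
  simp only [label_amalgVertex, Finset.sum_add_distrib, Finset.sum_const, Finset.card_univ,
    Fintype.card_fin, smul_eq_mul, mul_one]
  congr 1
  refine Finset.sum_congr rfl fun b _ => ?_
  rw [cell, if_pos (by omega)]

theorem totalWeight_eq (hm : 0 < m) (hodd : Odd n) (hr : 3 ≤ r) (hrn : r < n) (i i' : Fin m)
    (j : Fin n) :
    (amalgComplete m n r).totalWeight (labeling m n r) (amalgVertex m n r i j) =
      (amalgComplete m n r).totalWeight (labeling m n r) (amalgVertex m n r i' j) := by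
  by_cases hj : (j : ℕ) < n - r
  · rw [totalWeight_own hm hrn i hj, totalWeight_own hm hrn i' hj,
      row_sum_eq hr (by rwa [Nat.sub_add_cancel hrn.le]) i.2 i'.2 hj]
  · rw [amalgVertex_congr fun h => absurd h hj]

theorem isLocalAntimagicTotal_labeling (hm : 0 < m) (hr : 2 ≤ r) (hrn : r < n) :
    (amalgComplete m n r).IsLocalAntimagicTotal (labeling m n r) := by
  refine ⟨labeling_bijOn hm (by omega) hrn, ?_⟩
  rintro _ _ ⟨hne, i, j, k, rfl, rfl⟩
  rcases lt_trichotomy j k with h | rfl | h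
  · exact (totalWeight_lt hm hr hrn i h).ne
  · exact absurd rfl hne
  · exact (totalWeight_lt hm hr hrn i h).ne'

/-! ### Counting the weights -/

theorem le_ncard_range_totalWeight (hm : 0 < m)
    {f : AmalgVertex m n r ⊕ (amalgComplete m n r).edgeSet → ℕ}
    (hf : (amalgComplete m n r).IsLocalAntimagicTotal f) :
    n ≤ (Set.range ((amalgComplete m n r).totalWeight f)).ncard := by
  have hinj : Function.Injective
      fun j => (amalgComplete m n r).totalWeight f (amalgVertex m n r ⟨0, hm⟩ j) := by
    intro j k h
    by_contra hne
    exact hf.2 _ _ ⟨fun h => hne (amalgVertex_inj h).1, _, _, _, rfl, rfl⟩ h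
  calc n = (Set.range fun j =>
        (amalgComplete m n r).totalWeight f (amalgVertex m n r ⟨0, hm⟩ j)).ncard := by
        rw [Set.ncard_range_of_injective hinj, Nat.card_eq_fintype_card, Fintype.card_fin]
    _ ≤ _ := Set.ncard_le_ncard
        (by rintro _ ⟨j, rfl⟩; exact ⟨_, rfl⟩) (Set.finite_range _)

theorem ncard_range_totalWeight_labeling_le (hm : 0 < m) (hodd : Odd n) (hr : 3 ≤ r)
    (hrn : r < n) :
    (Set.range ((amalgComplete m n r).totalWeight (labeling m n r))).ncard ≤ n := by
  have hsub : Set.range ((amalgComplete m n r).totalWeight (labeling m n r)) ⊆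
      Set.range fun j => (amalgComplete m n r).totalWeight (labeling m n r)
        (amalgVertex m n r ⟨0, hm⟩ j) := by
    rintro _ ⟨v, rfl⟩
    obtain ⟨i, j, rfl⟩ := exists_amalgVertex_eq hm hrn v
    exact ⟨j, totalWeight_eq hm hodd hr hrn _ _ j⟩
  refine (Set.ncard_le_ncard hsub (Set.finite_range _)).trans ?_
  rw [← Set.image_univ]
  refine (Set.ncard_image_le Set.finite_univ).trans ?_
  rw [Set.ncard_univ, Nat.card_eq_fintype_card, Fintype.card_fin]

end AmalgLabel

open AmalgLabel in
theorem mainTheorem2 (m n r : ℕ) (hm : 2 ≤ m) (hn : 3 ≤ n) (hodd : Odd n)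
    (hr : 3 ≤ r) (hrn : r < n) :
    (amalgComplete m n r).latChromaticNumber = n := by
  have hm0 : 0 < m := by omega
  have hf := isLocalAntimagicTotal_labeling (n := n) (r := r) hm0 (by omega) hrn
  have hmem : n ∈ {k : ℕ | ∃ f : AmalgVertex m n r ⊕ (amalgComplete m n r).edgeSet → ℕ,
      (amalgComplete m n r).IsLocalAntimagicTotal f ∧
        (Set.range ((amalgComplete m n r).totalWeight f)).ncard = k} :=
    ⟨labeling m n r, hf, le_antisymm (ncard_range_totalWeight_labeling_le hm0 hodd hr hrn)
      (le_ncard_range_totalWeight hm0 hf)⟩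
  refine le_antisymm (Nat.sInf_le hmem) (le_csInf ⟨n, hmem⟩ ?_)
  rintro k ⟨f, hf, rfl⟩
  exact le_ncard_range_totalWeight hm0 hf
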